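/- Let $\mathcal{O}$ be the ring of entire functions $\mathbb{C}\to\mathbb{C}$ with pointwise addition and multiplication, let $R$ be a commutative ring (with $1$), and let $\mathscr{L}\colon R\to\mathcal{O}$ be an injective (unital) ring homomorphism, through which $\mathcal{O}$ is regarded as an $R$-algebra. Let $P$ be a finite matrix over $R$, and let $\Sigma$ be a (finitely presented) $R$-module with presentation matrix $P$, i.e. $\Sigma\cong[v]/[Pv]$, where $[v]$ is the free $R$-module whose basis is the column vector $v$ of as many elements as $P$ has columns, and $[Pv]$ is the submodule of $[v]$ spanned by the entries of $Pv$. Let $\hat P=\mathscr{L}(P)$ be the matrix over $\mathcal{O}$ obtained by applying $\mathscr{L}$ to every entry of $P$. Then the following two conditions are equivalent: (i) there is $k\in\mathbb{N}$ such that $\operatorname{rank}\hat P(\sigma)=k$ for all $\sigma\in\mathbb{C}$; (ii) the $\mathcal{O}$-module $\Sigma_{\mathcal{O}}=\mathcal{O}\otimes_R\Sigma$ is free. If these conditions hold, $\Sigma$ is said to be spectrally controllable. -/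

import Mathlib

open scoped TensorProduct

/-- The ring `𝒪` of entire functions `ℂ → ℂ`, with pointwise addition and multiplication. -/
def EntireRing : Subring (ℂ → ℂ) where
  carrier := {f | Differentiable ℂ f}
  mul_mem' := fun hf hg => Differentiable.mul hf hg
  one_mem' := differentiable_const (1 : ℂ)
  add_mem' := fun hf hg => Differentiable.add hf hg
  zero_mem' := differentiable_const (0 : ℂ)
  neg_mem' := fun hf => Differentiable.neg hf

/-- `P` is a presentation matrix of the `R`-module `M`: `M` is isomorphic to `[v] / [P v]`, where
`[v]` is free with basis `v = (v_j)` and `[P v]` is the submodule spanned by the entries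
`∑ j, P i j • v_j` of `P v`, that is, by the rows of `P` in `R ^ n`. -/
def IsPresentationMatrix {R : Type*} [CommRing R] {m n : Type*} [Fintype m] [Fintype n]
    (P : Matrix m n R) (M : Type*) [AddCommGroup M] [Module R M] : Prop :=
  Nonempty (M ≃ₗ[R] ((n → R) ⧸ Submodule.span R (Set.range fun i : m => P i)))

/-- The matrix over `𝒪` obtained from `P` by applying `L` to every entry. -/
def laplaceImage {R : Type*} [CommRing R] {m n : Type*}
    (L : R →+* EntireRing) (P : Matrix m n R) : Matrix m n EntireRing :=
  P.map L

/-- The complex matrix of the values at `σ` of a matrix of entire functions. -/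
def evalMatrixAt {m n : Type*} (Q : Matrix m n EntireRing) (σ : ℂ) : Matrix m n ℂ :=
  Q.map fun f => (f : ℂ → ℂ) σ

/-- The spectral (rank) condition on a presentation matrix: the image of `P` under `L` has the same
rank at all complex points. -/
def IsSpectrallyControllable {R : Type*} [CommRing R] {m n : Type*} [Fintype m] [Fintype n]
    (L : R →+* EntireRing) (P : Matrix m n R) : Prop :=
  ∃ k : ℕ, ∀ σ : ℂ, (evalMatrixAt (laplaceImage L P) σ).rank = k

/-- `𝒪 ⊗_R M` is a free `𝒪`-module, where `𝒪` is an `R`-algebra through `L`. -/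
def IsEntireFreeControllable {R : Type*} [CommRing R] (L : R →+* EntireRing)
    (M : Type*) [AddCommGroup M] [Module R M] : Prop :=
  letI : Algebra R EntireRing := L.toAlgebra
  Module.Free EntireRing (EntireRing ⊗[R] M)

/-!
Write `Q` for the matrix of entire functions obtained from `P`. Base change is right exact, so
`𝒪 ⊗ M` is the cokernel `𝒪 ^ n / (row space of Q)`
(`Matrix.nonempty_baseChange_quotient_equiv`), and the claim concerns `Q` alone.

If this cokernel is free, or merely projective, the row space of `Q` is a direct summand of `𝒪 ^ n`,
hence the row space of an idempotent matrix `e`. The rank of `Q σ` is then the trace of `e σ`: an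
entire function of `σ` with values in `ℕ`, so a constant.

The converse rests on the fact that `𝒪` is a Bézout domain. On a disc, two entire functions are
polynomials up to nowhere vanishing factors, so they have a greatest common divisor with Bézout
coefficients there (`exists_local_bezout`). The choices on the discs `|z| < n` are patched by the
additive Cousin problem (`exists_coboundary_ball`): the divisors differ by units, whose logarithms
are made a coboundary, and the Bézout coefficients differ by multiples of `(G, -F)`, whose factors
are made a coboundary in turn (`exists_entire_bezout`, `exists_global_bezout`). This replaces both
the Weierstrass product and the Mittag-Leffler theorem.

Over a Bézout domain finite submodules of free modules of finite rank are free. Taking a basis of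
the row space of `Q`, and then one of the column space of the resulting matrix, reduces `Q` to a
square matrix `D` with `det D ≠ 0` whose values have the same ranks
(`Matrix.exists_core_of_isBezout`). If these ranks are constant, `D σ` is invertible for every `σ`,
since it is for some `σ`. So `det D` has no zeros and is a unit of `𝒪`, and `Q` has a generalized
inverse `H`, `Q H Q = Q`. The cokernel then embeds in `𝒪 ^ n`, and it is free because it is finite.
-/

open scoped Matrix

/-! ### Gluing and the additive Cousin problem on the discs `|z| < n` -/

open Metric Filter Topology in
/-- Functions on the discs `|z| < n` that agree on overlaps glue to an entire function. -/
theorem exists_differentiable_eqOn_ball {φ : ℕ → ℂ → ℂ}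
    (hφ : ∀ n, DifferentiableOn ℂ (φ n) (ball 0 n))
    (h : ∀ n : ℕ, ∀ z ∈ ball (0 : ℂ) n, φ (n + 1) z = φ n z) :
    ∃ Φ : ℂ → ℂ, Differentiable ℂ Φ ∧ ∀ n : ℕ, ∀ z ∈ ball (0 : ℂ) n, Φ z = φ n z := by
  have hmono : ∀ n k : ℕ, ∀ z ∈ ball (0 : ℂ) n, φ (n + k) z = φ n z := by
    intro n k z hz
    induction k with
    | zero => rfl
    | succ k ih =>
      rw [← ih, ← add_assoc]
      refine h _ z (ball_subset_ball ?_ hz)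
      push_cast
      linarith [(Nat.cast_nonneg k : (0 : ℝ) ≤ k)]
  have hmem : ∀ z : ℂ, z ∈ ball (0 : ℂ) ((⌊‖z‖⌋₊ + 1 : ℕ) : ℝ) := by
    intro z
    rw [mem_ball_zero_iff]
    push_cast
    exact Nat.lt_floor_add_one _
  have hval : ∀ n : ℕ, ∀ z ∈ ball (0 : ℂ) n, φ (⌊‖z‖⌋₊ + 1) z = φ n z := by
    intro n z hz
    rcases le_total n (⌊‖z‖⌋₊ + 1) with hle | hle
    · obtain ⟨k, hk⟩ := Nat.exists_eq_add_of_le hle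
      rw [hk]
      exact hmono n k z hz
    · obtain ⟨k, hk⟩ := Nat.exists_eq_add_of_le hle
      rw [hk]
      exact (hmono _ k z (hmem z)).symm
  refine ⟨fun z => φ (⌊‖z‖⌋₊ + 1) z, fun z => ?_, hval⟩
  have hn : ball (0 : ℂ) ((⌊‖z‖⌋₊ + 1 : ℕ) : ℝ) ∈ 𝓝 z := isOpen_ball.mem_nhds (hmem z)
  exact ((hφ _).differentiableAt hn).congr_of_eventuallyEq
    (Filter.eventuallyEq_of_mem hn fun w hw => hval _ w hw)

open Metric Filter Topology in
/-- A Taylor polynomial approximates a holomorphic function on a smaller disc. -/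
theorem exists_entire_norm_sub_le {u : ℂ → ℂ} {r s : ℝ} (hrs : r < s)
    (hu : DifferentiableOn ℂ u (ball 0 s)) {ε : ℝ} (hε : 0 < ε) :
    ∃ q : ℂ → ℂ, Differentiable ℂ q ∧ ∀ z ∈ ball (0 : ℂ) r, ‖u z - q z‖ ≤ ε := by
  rcases le_or_gt r 0 with hr | hr
  · exact ⟨0, differentiable_const 0, fun z hz => by simp [ball_eq_empty.2 hr] at hz⟩
  obtain ⟨t, hrt, hts⟩ := exists_between hrs
  lift r to NNReal using hr.le
  lift t to NNReal using (hr.trans hrt).le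
  have hp := (hu.mono (closedBall_subset_ball hts)).hasFPowerSeriesOnBall
    (by exact_mod_cast hr.trans hrt)
  have hunif := hp.tendstoUniformlyOn' (r' := r) (by exact_mod_cast hrt)
  obtain ⟨n, hn⟩ := (Metric.tendstoUniformlyOn_iff.1 hunif ε hε).exists
  refine ⟨fun z => (cauchyPowerSeries u 0 t).partialSum n (z - 0), ?_, fun z hz => ?_⟩
  · have : (fun z : ℂ => (cauchyPowerSeries u 0 t).partialSum n (z - 0)) =
        fun z => ∑ i ∈ Finset.range n, z ^ i * (cauchyPowerSeries u 0 t).coeff i := by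
      funext z
      simp [FormalMultilinearSeries.partialSum]
    rw [this]
    fun_prop
  · rw [← dist_eq_norm]
    exact (hn z hz).le

open Metric in
/-- The additive Cousin problem for the exhaustion of the plane by the discs `|z| < n`: every
sequence of holomorphic functions is a coboundary. With entire approximations `q k` of `u k`, the
series `v n = ∑_{k < n} q k - ∑_{k ≥ n} (u k - q k)` solves it. -/
theorem exists_coboundary_ball {u : ℕ → ℂ → ℂ}
    (hu : ∀ n, DifferentiableOn ℂ (u n) (ball 0 n)) :
    ∃ v : ℕ → ℂ → ℂ, (∀ n, DifferentiableOn ℂ (v n) (ball 0 n)) ∧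
      ∀ n : ℕ, ∀ z ∈ ball (0 : ℂ) n, v (n + 1) z = v n z + u n z := by
  have hq : ∀ n : ℕ, ∃ q : ℂ → ℂ, Differentiable ℂ q ∧
      ∀ z ∈ ball (0 : ℂ) ((n : ℝ) - 1), ‖u n z - q z‖ ≤ (1 / 2 : ℝ) ^ n := fun n =>
    exists_entire_norm_sub_le (sub_one_lt _) (hu n) (by positivity)
  choose q hqd hqb using hq
  have hgeo : ∀ N : ℕ, Summable fun k : ℕ => (1 / 2 : ℝ) ^ (k + N) := fun N =>
    (summable_nat_add_iff N).2 summable_geometric_two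
  -- Beyond the index `n + 1` the terms `u k - q k` are small on the whole disc of radius `n`.
  have hbound : ∀ n k : ℕ, ∀ z ∈ ball (0 : ℂ) n,
      ‖u (k + (n + 1)) z - q (k + (n + 1)) z‖ ≤ (1 / 2 : ℝ) ^ (k + (n + 1)) := by
    intro n k z hz
    refine hqb _ z (ball_subset_ball ?_ hz)
    push_cast
    linarith [(Nat.cast_nonneg k : (0 : ℝ) ≤ k)]
  have hsum : ∀ n : ℕ, ∀ z ∈ ball (0 : ℂ) n, Summable fun k => u (k + n) z - q (k + n) z := by
    intro n z hz
    have := Summable.of_norm_bounded (hgeo (n + 1)) fun k => hbound n k z hz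
    have h2 := (summable_nat_add_iff (f := fun k => u k z - q k z) (n + 1)).1 this
    exact (summable_nat_add_iff (f := fun k => u k z - q k z) n).2 h2
  have hsplit : ∀ n : ℕ, ∀ z ∈ ball (0 : ℂ) n, ∑' k, (u (k + n) z - q (k + n) z) =
      (u n z - q n z) + ∑' k, (u (k + (n + 1)) z - q (k + (n + 1)) z) := by
    intro n z hz
    rw [(hsum n z hz).tsum_eq_zero_add]
    simp [add_assoc, add_comm 1]
  refine ⟨fun n z => ∑ k ∈ Finset.range n, q k z - ∑' k, (u (k + n) z - q (k + n) z),
    fun n => ?_, fun n z hz => ?_⟩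
  · refine DifferentiableOn.sub (by fun_prop) ?_
    refine DifferentiableOn.congr (f := fun z => (u n z - q n z) +
      ∑' k, (u (k + (n + 1)) z - q (k + (n + 1)) z)) ?_ (hsplit n)
    refine ((hu n).sub (hqd n).differentiableOn).add ?_
    refine Complex.differentiableOn_tsum_of_summable_norm (hgeo (n + 1)) (fun k => ?_) isOpen_ball
      (hbound n)
    refine ((hu _).mono (ball_subset_ball ?_)).sub (hqd _).differentiableOn
    push_cast
    linarith [(Nat.cast_nonneg k : (0 : ℝ) ≤ k)]
  · simp only [hsplit n z hz, Finset.sum_range_succ]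
    ring

open Metric in
/-- A nowhere vanishing holomorphic function on a disc has a logarithm there. -/
theorem exists_exp_eq_on_ball {s : ℂ → ℂ} {r : ℝ} (hs : DifferentiableOn ℂ s (ball 0 r))
    (h0 : ∀ z ∈ ball (0 : ℂ) r, s z ≠ 0) :
    ∃ u : ℂ → ℂ, DifferentiableOn ℂ u (ball 0 r) ∧
      ∀ z ∈ ball (0 : ℂ) r, Complex.exp (u z) = s z := by
  rcases le_or_gt r 0 with hr | hr
  · exact ⟨0, by simp [ball_eq_empty.2 hr], fun z hz => by simp [ball_eq_empty.2 hr] at hz⟩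
  have hc : (0 : ℂ) ∈ ball (0 : ℂ) r := mem_ball_self hr
  obtain ⟨w, hw⟩ := ((hs.deriv isOpen_ball).div hs h0).isExactOn_ball
  -- The derivative of `s * exp (-w)` vanishes, so a shift of `w` by a constant is a logarithm.
  have hd : ∀ z ∈ ball (0 : ℂ) r,
      HasDerivAt (fun z => s z * Complex.exp (-w z)) 0 z := by
    intro z hz
    have h1 := (hs.differentiableAt (isOpen_ball.mem_nhds hz)).hasDerivAt
    have h2 := (hw z hz).neg.cexp
    refine (h1.mul h2).congr_deriv ?_
    have := h0 z hz
    rw [Pi.div_apply, Pi.neg_apply]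
    field_simp
    ring
  have hconst : ∀ z ∈ ball (0 : ℂ) r, s z * Complex.exp (-w z) = s 0 * Complex.exp (-w 0) :=
    fun z hz => (isOpen_ball.is_const_of_deriv_eq_zero (convex_ball 0 r).isPreconnected
      (fun z hz => (hd z hz).differentiableAt.differentiableWithinAt)
      (fun z hz => (hd z hz).deriv) hz hc)
  refine ⟨fun z => w z + (Complex.log (s 0) - w 0), ?_, fun z hz => ?_⟩
  · exact fun z hz =>
      ((hw z hz).add_const _).differentiableAt.differentiableWithinAt
  · have := hconst z hz
    beta_reduce
    rw [show w z + (Complex.log (s 0) - w 0) = Complex.log (s 0) + (-w 0) + w z by ring,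
      Complex.exp_add, Complex.exp_add, Complex.exp_log (h0 0 hc), ← this, mul_assoc,
      ← Complex.exp_add]
    simp

/-! ### Zeros of entire functions -/

open Metric Filter Topology in
/-- A nonzero entire function is a non-zero-divisor among the holomorphic functions on a disc. -/
theorem eqOn_zero_of_entire_mul_eq_zero {f φ : ℂ → ℂ} {r : ℝ} (hf : Differentiable ℂ f)
    (hf0 : f ≠ 0) (hφ : DifferentiableOn ℂ φ (ball 0 r))
    (h : ∀ z ∈ ball (0 : ℂ) r, f z * φ z = 0) : ∀ z ∈ ball (0 : ℂ) r, φ z = 0 := by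
  have hfa : AnalyticOnNhd ℂ f Set.univ := fun z _ => hf.analyticAt z
  rcases (hfa.mono (Set.subset_univ _)).eq_zero_or_eq_zero_of_mul_eq_zero
    (hφ.analyticOnNhd isOpen_ball) h (convex_ball 0 r).isPreconnected with h1 | h1
  · intro z hz
    refine absurd (funext fun w => ?_) hf0
    exact hfa.eqOn_zero_of_preconnected_of_eventuallyEq_zero isPreconnected_univ
      (Set.mem_univ z) (eventuallyEq_of_mem (isOpen_ball.mem_nhds hz) h1) (Set.mem_univ w)
  · exact h1

open Filter Topology in
/-- The zeros of a nonzero entire function in a compact set are finite in number. -/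
theorem finite_zeros_inter_isCompact {f : ℂ → ℂ} (hf : Differentiable ℂ f) (hf0 : f ≠ 0)
    {K : Set ℂ} (hK : IsCompact K) : {z ∈ K | f z = 0}.Finite := by
  by_contra hinf
  obtain ⟨x, -, hx⟩ := Set.Infinite.exists_accPt_of_subset_isCompact hinf hK fun z hz => hz.1
  refine hf0 (AnalyticOnNhd.eq_of_frequently_eq (z₀ := x) (fun z _ => hf.analyticAt z)
    (fun z _ => analyticAt_const) ?_)
  exact (accPt_iff_frequently_nhdsNE.1 hx).mono fun z hz => hz.2

open Filter Topology in
/-- Splitting off the full order of vanishing at a point. -/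
theorem exists_eq_pow_sub_mul {f : ℂ → ℂ} (hf : Differentiable ℂ f) (hf0 : f ≠ 0) (c : ℂ) :
    ∃ (k : ℕ) (h : ℂ → ℂ), Differentiable ℂ h ∧ (∀ z, f z = (z - c) ^ k * h z) ∧ h c ≠ 0 := by
  by_contra! hcon
  have hall : ∀ k : ℕ, ∃ h : ℂ → ℂ, Differentiable ℂ h ∧ ∀ z, f z = (z - c) ^ k * h z := by
    intro k
    induction k with
    | zero => exact ⟨f, hf, fun z => by simp⟩
    | succ k ih =>
      obtain ⟨h, hd, hfh⟩ := ih
      refine ⟨dslope h c, ?_, fun z => ?_⟩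
      · rw [← differentiableOn_univ] at hd ⊢
        exact (Complex.differentiableOn_dslope univ_mem).2 hd
      · have := sub_smul_dslope h c z
        rw [hcon k h hd hfh, sub_zero, smul_eq_mul] at this
        rw [hfh z, ← this]
        ring
  have htop : analyticOrderAt f c = ⊤ := by
    refine ENat.eq_top_iff_forall_ge.2 fun k => ?_
    obtain ⟨h, hd, hfh⟩ := hall k
    exact (natCast_le_analyticOrderAt (hf.analyticAt c)).2
      ⟨h, hd.analyticAt c, Eventually.of_forall hfh⟩
  refine hf0 (funext fun w => ?_)
  exact AnalyticOnNhd.eqOn_zero_of_preconnected_of_eventuallyEq_zero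
    (fun z _ => hf.analyticAt z) isPreconnected_univ (Set.mem_univ c)
    (analyticOrderAt_eq_top.1 htop) (Set.mem_univ w)

/-- On a compact set, a nonzero entire function is a polynomial times a function without zeros. -/
theorem exists_eq_polynomial_mul {K : Set ℂ} (hK : IsCompact K) {f : ℂ → ℂ}
    (hf : Differentiable ℂ f) (hf0 : f ≠ 0) :
    ∃ (p : Polynomial ℂ) (h : ℂ → ℂ), p ≠ 0 ∧ Differentiable ℂ h ∧
      (∀ z, f z = p.eval z * h z) ∧ ∀ z ∈ K, h z ≠ 0 := by
  induction hN : {z ∈ K | f z = 0}.ncard using Nat.strong_induction_on generalizing f with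
  | _ N ih =>
    by_cases hz : ∀ z ∈ K, f z ≠ 0
    · exact ⟨1, f, one_ne_zero, hf, by simp, hz⟩
    push Not at hz
    obtain ⟨c, hcK, hc⟩ := hz
    obtain ⟨k, h, hd, hfh, hhc⟩ := exists_eq_pow_sub_mul hf hf0 c
    have hh0 : h ≠ 0 := fun h0 => hhc (by simp [h0])
    have hlt : {z ∈ K | h z = 0}.ncard < N := by
      rw [← hN]
      refine Set.ncard_lt_ncard ⟨fun z hz => ⟨hz.1, by simp [hfh, hz.2]⟩, fun hsub => ?_⟩
        (finite_zeros_inter_isCompact hf hf0 hK)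
      exact hhc (hsub ⟨hcK, hc⟩).2
    obtain ⟨p, g, hp, hg, hpg, hgK⟩ := ih _ hlt hd hh0 rfl
    refine ⟨(Polynomial.X - Polynomial.C c) ^ k * p, g,
      mul_ne_zero (pow_ne_zero _ (Polynomial.X_sub_C_ne_zero c)) hp, hg, fun z => ?_, hgK⟩
    rw [hfh, hpg]
    simp [mul_assoc]

/-! ### The ring of entire functions is a Bézout domain -/

/-- On a disc two nonzero entire functions have a greatest common divisor with Bézout coefficients:
up to units they are polynomials there. -/
theorem exists_local_bezout {f g : ℂ → ℂ} (hf : Differentiable ℂ f) (hf0 : f ≠ 0)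
    (hg : Differentiable ℂ g) (hg0 : g ≠ 0) (r : ℝ) :
    ∃ d F G a b : ℂ → ℂ, Differentiable ℂ d ∧ Differentiable ℂ F ∧ Differentiable ℂ G ∧
      DifferentiableOn ℂ a (Metric.ball 0 r) ∧ DifferentiableOn ℂ b (Metric.ball 0 r) ∧
      (∀ z, f z = d z * F z) ∧ (∀ z, g z = d z * G z) ∧
      ∀ z ∈ Metric.ball (0 : ℂ) r, a z * F z + b z * G z = 1 := by
  obtain ⟨p, h, hp, hh, hfp, hhK⟩ := exists_eq_polynomial_mul (isCompact_closedBall 0 r) hf hf0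
  obtain ⟨q, k, hq, hk, hgq, hkK⟩ := exists_eq_polynomial_mul (isCompact_closedBall 0 r) hg hg0
  obtain ⟨p', hp'⟩ := EuclideanDomain.gcd_dvd_left p q
  obtain ⟨q', hq'⟩ := EuclideanDomain.gcd_dvd_right p q
  have hd0 : EuclideanDomain.gcd p q ≠ 0 := fun h0 => hp (EuclideanDomain.gcd_eq_zero_iff.1 h0).1
  have hbez := EuclideanDomain.gcd_eq_gcd_ab p q
  set d := EuclideanDomain.gcd p q
  set α := EuclideanDomain.gcdA p q
  set β := EuclideanDomain.gcdB p q
  have h1 : p' * α + q' * β = 1 := by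
    refine mul_left_cancel₀ hd0 ?_
    calc d * (p' * α + q' * β) = (d * p') * α + (d * q') * β := by ring
      _ = d * 1 := by rw [← hp', ← hq', ← hbez, mul_one]
  refine ⟨fun z => d.eval z, fun z => p'.eval z * h z, fun z => q'.eval z * k z,
    fun z => α.eval z / h z, fun z => β.eval z / k z, d.differentiable,
    p'.differentiable.mul hh, q'.differentiable.mul hk,
    α.differentiable.differentiableOn.div hh.differentiableOn
      fun z hz => hhK z (Metric.ball_subset_closedBall hz),
    β.differentiable.differentiableOn.div hk.differentiableOn
      fun z hz => hkK z (Metric.ball_subset_closedBall hz),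
    fun z => ?_, fun z => ?_, fun z hz => ?_⟩
  · rw [hfp, hp', Polynomial.eval_mul, mul_assoc]
  · rw [hgq, hq', Polynomial.eval_mul, mul_assoc]
  · have hhz := hhK z (Metric.ball_subset_closedBall hz)
    have hkz := hkK z (Metric.ball_subset_closedBall hz)
    have := congrArg (Polynomial.eval z) h1
    simp only [Polynomial.eval_add, Polynomial.eval_mul, Polynomial.eval_one] at this
    rw [← this]
    field_simp

open Metric in
/-- Local Bézout identities `a F + b G = 1` can be glued: consecutive solutions differ by
`(G w, -F w)`, and the additive Cousin problem removes `w`. -/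
theorem exists_global_bezout {F G : ℂ → ℂ} (hF : Differentiable ℂ F) (hG : Differentiable ℂ G)
    {a b : ℕ → ℂ → ℂ} (ha : ∀ n, DifferentiableOn ℂ (a n) (ball 0 n))
    (hb : ∀ n, DifferentiableOn ℂ (b n) (ball 0 n))
    (hab : ∀ n : ℕ, ∀ z ∈ ball (0 : ℂ) n, a n z * F z + b n z * G z = 1) :
    ∃ A B : ℂ → ℂ, Differentiable ℂ A ∧ Differentiable ℂ B ∧ ∀ z, A z * F z + B z * G z = 1 := by
  have hsub : ∀ n : ℕ, ball (0 : ℂ) n ⊆ ball 0 (n + 1 : ℕ) := fun n =>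
    ball_subset_ball (by push_cast; linarith)
  obtain ⟨v, hv, hvw⟩ := exists_coboundary_ball
    (u := fun n z => a (n + 1) z * b n z - b (n + 1) z * a n z) fun n =>
    (((ha (n + 1)).mono (hsub n)).mul (hb n)).sub (((hb (n + 1)).mono (hsub n)).mul (ha n))
  obtain ⟨A, hA, hAn⟩ := exists_differentiable_eqOn_ball (φ := fun n z => a n z - G z * v n z)
    (fun n => (ha n).sub (hG.differentiableOn.mul (hv n))) (by
      intro n z hz
      have h1 := hab n z hz
      have h2 := hab (n + 1) z (hsub n hz)
      simp only [hvw n z hz]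
      linear_combination a n z * h2 - a (n + 1) z * h1)
  obtain ⟨B, hB, hBn⟩ := exists_differentiable_eqOn_ball (φ := fun n z => b n z + F z * v n z)
    (fun n => (hb n).add (hF.differentiableOn.mul (hv n))) (by
      intro n z hz
      have h1 := hab n z hz
      have h2 := hab (n + 1) z (hsub n hz)
      simp only [hvw n z hz]
      linear_combination b n z * h2 - b (n + 1) z * h1)
  refine ⟨A, B, hA, hB, fun z => ?_⟩
  obtain ⟨n, hn⟩ := exists_nat_gt ‖z‖
  have hz : z ∈ ball (0 : ℂ) n := mem_ball_zero_iff.2 hn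
  rw [hAn n z hz, hBn n z hz]
  linear_combination hab n z hz

open Metric in
/-- Two nonzero entire functions have a greatest common divisor `d` with Bézout coefficients. The
local ones on the discs `|z| < n` differ by units; their logarithms are made a coboundary. -/
theorem exists_entire_bezout {f g : ℂ → ℂ} (hf : Differentiable ℂ f) (hf0 : f ≠ 0)
    (hg : Differentiable ℂ g) (hg0 : g ≠ 0) :
    ∃ d F G a b : ℂ → ℂ, Differentiable ℂ d ∧ Differentiable ℂ F ∧ Differentiable ℂ G ∧
      Differentiable ℂ a ∧ Differentiable ℂ b ∧
      (∀ z, f z = d z * F z) ∧ (∀ z, g z = d z * G z) ∧ ∀ z, a z * F z + b z * G z = 1 := by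
  have hsub : ∀ n : ℕ, ball (0 : ℂ) n ⊆ ball 0 (n + 1 : ℕ) := fun n =>
    ball_subset_ball (by push_cast; linarith)
  choose d F G a b hd hF hG ha hb hfd hgd hab using
    fun n : ℕ => exists_local_bezout hf hf0 hg hg0 (n : ℝ)
  -- The transition functions: `d (n + 1) = d n * s n` and `d n = d (n + 1) * s' n`.
  let s : ℕ → ℂ → ℂ := fun n z => a (n + 1) z * F n z + b (n + 1) z * G n z
  let s' : ℕ → ℂ → ℂ := fun n z => a n z * F (n + 1) z + b n z * G (n + 1) z
  have hsd : ∀ n, DifferentiableOn ℂ (s n) (ball 0 n) := fun n =>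
    (((ha (n + 1)).mono (hsub n)).mul (hF n).differentiableOn).add
      (((hb (n + 1)).mono (hsub n)).mul (hG n).differentiableOn)
  have hsd' : ∀ n, DifferentiableOn ℂ (s' n) (ball 0 n) := fun n =>
    ((ha n).mul (hF _).differentiableOn).add ((hb n).mul (hG _).differentiableOn)
  have hds : ∀ n : ℕ, ∀ z ∈ ball (0 : ℂ) n, d (n + 1) z = d n z * s n z := by
    intro n z hz
    have h2 := hab (n + 1) z (hsub n hz)
    have hf1 := (hfd n z).symm.trans (hfd (n + 1) z)
    have hg1 := (hgd n z).symm.trans (hgd (n + 1) z)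
    simp only [s]
    linear_combination -d (n + 1) z * h2 - a (n + 1) z * hf1 - b (n + 1) z * hg1
  have hds' : ∀ n : ℕ, ∀ z ∈ ball (0 : ℂ) n, d n z = d (n + 1) z * s' n z := by
    intro n z hz
    have h2 := hab n z hz
    have hf1 := (hfd n z).symm.trans (hfd (n + 1) z)
    have hg1 := (hgd n z).symm.trans (hgd (n + 1) z)
    simp only [s']
    linear_combination -d n z * h2 + a n z * hf1 + b n z * hg1
  have hss : ∀ n : ℕ, ∀ z ∈ ball (0 : ℂ) n, s n z * s' n z - 1 = 0 := by
    intro n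
    refine eqOn_zero_of_entire_mul_eq_zero hf hf0
      (((hsd n).mul (hsd' n)).sub (differentiableOn_const 1)) fun z hz => ?_
    have h1 := hds n z hz
    have h2 := hds' n z hz
    rw [hfd n z]
    linear_combination -F n z * h2 - F n z * s' n z * h1
  have hs0 : ∀ n : ℕ, ∀ z ∈ ball (0 : ℂ) n, s n z ≠ 0 := by
    intro n z hz h0
    have := hss n z hz
    simp [h0] at this
  choose u hu hus using fun n => exists_exp_eq_on_ball (hsd n) (hs0 n)
  obtain ⟨v, hv, hvu⟩ := exists_coboundary_ball hu
  have hvs : ∀ n : ℕ, ∀ z ∈ ball (0 : ℂ) n,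
      Complex.exp (v (n + 1) z) = Complex.exp (v n z) * s n z := by
    intro n z hz
    rw [hvu n z hz, Complex.exp_add, hus n z hz]
  have hcofactor : ∀ (φ : ℂ → ℂ) (H : ℕ → ℂ → ℂ), (∀ n, Differentiable ℂ (H n)) →
      (∀ n z, φ z = d n z * H n z) →
      ∃ Φ : ℂ → ℂ, Differentiable ℂ Φ ∧
        ∀ n : ℕ, ∀ z ∈ ball (0 : ℂ) n, Φ z = H n z * Complex.exp (v n z) := by
    intro φ H hH hφ
    refine exists_differentiable_eqOn_ball
      (fun n => (hH n).differentiableOn.mul (hv n).cexp) fun n => ?_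
    have key : ∀ z ∈ ball (0 : ℂ) n, s n z * H (n + 1) z - H n z = 0 := by
      refine eqOn_zero_of_entire_mul_eq_zero hf hf0
        (((hsd n).mul (hH _).differentiableOn).sub (hH n).differentiableOn) fun z hz => ?_
      have h1 := hds n z hz
      have h2 := (hφ n z).symm.trans (hφ (n + 1) z)
      rw [hfd n z]
      linear_combination -F n z * H (n + 1) z * h1 - F n z * h2
    intro z hz
    simp only [hvs n z hz]
    linear_combination Complex.exp (v n z) * key z hz
  obtain ⟨F', hF', hFn⟩ := hcofactor f F hF hfd
  obtain ⟨G', hG', hGn⟩ := hcofactor g G hG hgd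
  have hexp : ∀ n z, Complex.exp (-v n z) * Complex.exp (v n z) = 1 := by
    intro n z
    rw [← Complex.exp_add]
    simp
  obtain ⟨D, hD, hDn⟩ := exists_differentiable_eqOn_ball
    (φ := fun n z => d n z * Complex.exp (-v n z))
    (fun n => (hd n).differentiableOn.mul (hv n).neg.cexp) (by
      intro n z hz
      have h1 := hexp n z
      have h2 := hexp (n + 1) z
      rw [hvs n z hz] at h2
      have h3 := hds n z hz
      linear_combination d n z * Complex.exp (-v n z) * h2 + Complex.exp (-v (n + 1) z) * h3
        - d n z * s n z * Complex.exp (-v (n + 1) z) * h1)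
  obtain ⟨A, B, hA, hB, hAB⟩ := exists_global_bezout hF' hG'
    (a := fun n z => a n z * Complex.exp (-v n z)) (b := fun n z => b n z * Complex.exp (-v n z))
    (fun n => (ha n).mul (hv n).neg.cexp) (fun n => (hb n).mul (hv n).neg.cexp) (by
      intro n z hz
      rw [hFn n z hz, hGn n z hz]
      linear_combination hab n z hz + (a n z * F n z + b n z * G n z) * hexp n z)
  refine ⟨D, F', G', A, B, hD, hF', hG', hA, hB, fun z => ?_, fun z => ?_, hAB⟩
  all_goals
    obtain ⟨n, hn⟩ := exists_nat_gt ‖z‖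
    have hz : z ∈ ball (0 : ℂ) n := mem_ball_zero_iff.2 hn
    rw [hDn n z hz]
  · rw [hFn n z hz, hfd n z]
    linear_combination -d n z * F n z * hexp n z
  · rw [hGn n z hz, hgd n z]
    linear_combination -d n z * G n z * hexp n z

instance : IsDomain EntireRing := by
  have : NoZeroDivisors EntireRing := by
    refine ⟨fun {f g} h => ?_⟩
    have hmul : ∀ z ∈ Set.univ, (f : ℂ → ℂ) z * (g : ℂ → ℂ) z = 0 := fun z _ =>
      congrFun (congrArg Subtype.val h) z
    rcases AnalyticOnNhd.eq_zero_or_eq_zero_of_mul_eq_zero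
      (fun z _ => Differentiable.analyticAt f.2 z) (fun z _ => Differentiable.analyticAt g.2 z)
      hmul isPreconnected_univ with h1 | h1
    · exact Or.inl (Subtype.ext (funext fun z => h1 z trivial))
    · exact Or.inr (Subtype.ext (funext fun z => h1 z trivial))
  exact NoZeroDivisors.to_isDomain _

instance : IsBezout EntireRing := by
  refine IsBezout.iff_span_pair_isPrincipal.2 fun f g => ?_
  by_cases hf0 : f = 0
  · exact ⟨g, by simp [hf0, Ideal.submodule_span_eq]⟩
  by_cases hg0 : g = 0
  · exact ⟨f, by
      simp [hg0, Set.pair_comm f 0, Ideal.submodule_span_eq]⟩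
  obtain ⟨d, F, G, a, b, hd, hF, hG, ha, hb, hfd, hgd, hab⟩ := exists_entire_bezout f.2
    (fun h => hf0 (Subtype.ext h)) g.2 (fun h => hg0 (Subtype.ext h))
  refine ⟨⟨d, hd⟩, le_antisymm ?_ ?_⟩
  · rw [Ideal.submodule_span_eq, Ideal.span_le, Set.insert_subset_iff, Set.singleton_subset_iff]
    exact ⟨Ideal.mem_span_singleton.2 ⟨⟨F, hF⟩, Subtype.ext (funext hfd)⟩,
      Ideal.mem_span_singleton.2 ⟨⟨G, hG⟩, Subtype.ext (funext hgd)⟩⟩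
  · rw [Ideal.submodule_span_eq, Ideal.span_singleton_le_iff_mem, Ideal.mem_span_pair]
    refine ⟨⟨a, ha⟩, ⟨b, hb⟩, Subtype.ext (funext fun z => ?_)⟩
    change a z * (f : ℂ → ℂ) z + b z * (g : ℂ → ℂ) z = d z
    rw [hfd, hgd]
    linear_combination d z * hab z

/-- An entire function without zeros is a unit. -/
theorem EntireRing.isUnit_of_forall_ne_zero {f : EntireRing} (hf : ∀ z, (f : ℂ → ℂ) z ≠ 0) :
    IsUnit f :=
  IsUnit.of_mul_eq_one ⟨fun z => ((f : ℂ → ℂ) z)⁻¹, Differentiable.inv f.2 hf⟩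
    (Subtype.ext (funext fun z => mul_inv_cancel₀ (hf z)))

/-! ### Matrices over a Bézout domain -/

/-- Over a Bézout domain a finite submodule of `R ^ n` is free. The first coordinate maps it onto a
principal ideal, which is free, and the kernel of that map is a finite submodule of
`R ^ (n - 1)`. -/
theorem Module.Free.of_injective_pi_of_isBezout {R : Type*} [CommRing R] [IsDomain R] [IsBezout R]
    {N : Type*} [AddCommGroup N] [Module R N] [Module.Finite R N] {n : ℕ}
    (f : N →ₗ[R] (Fin n → R)) (hf : Function.Injective f) : Module.Free R N := by
  induction n generalizing N with
  | zero =>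
    have : Subsingleton N := hf.subsingleton
    infer_instance
  | succ n ih =>
    let φ : N →ₗ[R] R := LinearMap.proj 0 ∘ₗ f
    have hI : Module.Free R (LinearMap.range φ) := by
      obtain ⟨a, ha⟩ := IsBezout.isPrincipal_of_FG (LinearMap.range φ)
        (Module.Finite.iff_fg.1 inferInstance)
      rw [ha]
      by_cases ha0 : a = 0
      · have : Subsingleton (Submodule.span R {a}) := by
          rw [ha0, Submodule.span_zero_singleton]
          infer_instance
        infer_instance
      · exact Module.Free.of_equiv (LinearEquiv.toSpanNonzeroSingleton R R a ha0)
    obtain ⟨s, hs⟩ := φ.rangeRestrict.exists_rightInverse_of_surjective φ.range_rangeRestrict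
    let e := (LinearMap.exact_subtype_ker_map φ.rangeRestrict).splitSurjectiveEquiv
      (Submodule.injective_subtype _) ⟨s, hs⟩
    have hfin : Module.Finite R (LinearMap.ker φ.rangeRestrict) :=
      Module.Finite.of_surjective (LinearMap.fst R _ _ ∘ₗ e.1.toLinearMap)
        (Prod.fst_surjective.comp e.1.surjective)
    have hfree : Module.Free R (LinearMap.ker φ.rangeRestrict) := by
      refine ih (LinearMap.pi (fun i : Fin n => LinearMap.proj i.succ) ∘ₗ f ∘ₗ
        Submodule.subtype _) fun x y hxy => Subtype.ext (hf (funext fun i => ?_))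
      refine Fin.cases ?_ (fun i => congrFun hxy i) i
      have hx := congrArg Subtype.val x.2
      have hy := congrArg Subtype.val y.2
      exact hx.trans hy.symm
    exact Module.Free.of_equiv e.1.symm

/-- Over a Bézout domain the row space of a matrix has a basis: `P` factors through a matrix `B`
with independent rows and the same row space. -/
theorem Matrix.exists_row_basis_of_isBezout {R : Type*} [CommRing R] [IsDomain R] [IsBezout R]
    {m n : Type*} [Fintype m] [Fintype n] (P : Matrix m n R) :
    ∃ (t : ℕ) (B : Matrix (Fin t) n R) (X : Matrix m (Fin t) R) (Y : Matrix (Fin t) m R),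
      P = X * B ∧ B = Y * P ∧ Function.Injective B.vecMulLinear := by
  let e := LinearEquiv.funCongrLeft R R (Fintype.equivFin n).symm
  have : Module.Free R (LinearMap.range P.vecMulLinear) :=
    Module.Free.of_injective_pi_of_isBezout (e.toLinearMap ∘ₗ Submodule.subtype _)
      (e.injective.comp (Submodule.injective_subtype _))
  let b := Module.finBasis R (LinearMap.range P.vecMulLinear)
  have hrow : ∀ i, P i ∈ LinearMap.range P.vecMulLinear := by
    intro i
    rw [range_vecMulLinear]
    exact Submodule.subset_span ⟨i, rfl⟩
  choose Y hY using fun i => (b i).2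
  have hsum : ∀ c : Fin _ → R, c ᵥ* (Matrix.of fun i => (b i : n → R)) =
      ((∑ i, c i • b i : LinearMap.range P.vecMulLinear) : n → R) := by
    intro c
    ext j
    simp [Matrix.vecMul, dotProduct]
  refine ⟨_, Matrix.of fun i => (b i : n → R), Matrix.of fun i => b.repr ⟨P i, hrow i⟩,
    Matrix.of Y, ?_, ?_, ?_⟩
  · ext i j
    have := hsum (b.repr ⟨P i, hrow i⟩)
    rw [b.sum_repr] at this
    exact (congrFun this j).symm
  · ext i j
    exact (congrFun (hY i) j).symm
  · rw [← LinearMap.ker_eq_bot, LinearMap.ker_eq_bot']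
    intro c hc
    rw [Matrix.vecMulLinear_apply, hsum, Submodule.coe_eq_zero] at hc
    exact funext (Fintype.linearIndependent_iff.1 b.linearIndependent c hc)

/-- Over a Bézout domain every matrix has a nonsingular square core: `P = X B` and `B = Y P`, where
`B = D E`, `D = B G` and `det D ≠ 0`. Here the rows of `B` are a basis of the row space of `P`, and
the columns of `D` one of the column space of `B`. -/
theorem Matrix.exists_core_of_isBezout {R : Type*} [CommRing R] [IsDomain R] [IsBezout R]
    {m n : Type*} [Fintype m] [Fintype n] (P : Matrix m n R) :
    ∃ (t : ℕ) (B : Matrix (Fin t) n R) (X : Matrix m (Fin t) R) (Y : Matrix (Fin t) m R)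
      (D : Matrix (Fin t) (Fin t) R) (E : Matrix (Fin t) n R) (G : Matrix n (Fin t) R),
      P = X * B ∧ B = Y * P ∧ B = D * E ∧ D = B * G ∧ D.det ≠ 0 := by
  obtain ⟨t, B, X, Y, hPX, hBY, hB⟩ := P.exists_row_basis_of_isBezout
  obtain ⟨s, D, E, G, hBE, hDG, hD⟩ := Bᵀ.exists_row_basis_of_isBezout
  have hBE' : B = Dᵀ * Eᵀ := by rw [← Matrix.transpose_mul, ← hBE, Matrix.transpose_transpose]
  have hDG' : Dᵀ = B * Gᵀ := by
    rw [hDG, Matrix.transpose_mul, Matrix.transpose_transpose]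
  have hinj : Function.Injective Dᵀ.vecMulLinear := by
    refine fun x y hxy => hB ?_
    simp only [Matrix.vecMulLinear_apply] at hxy ⊢
    rw [hBE', ← Matrix.vecMul_vecMul, ← Matrix.vecMul_vecMul, hxy]
  have hle := card_le_of_injective R _ hinj
  have hge := card_le_of_injective R _ hD
  simp only [Fintype.card_fin] at hle hge
  obtain rfl : t = s := le_antisymm hle hge
  refine ⟨t, B, X, Y, Dᵀ, Eᵀ, Gᵀ, hPX, hBY, hBE', hDG', fun h0 => ?_⟩
  obtain ⟨v, hv, hv0⟩ := Matrix.exists_vecMul_eq_zero_iff.2 h0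
  exact hv (hinj (hv0.trans (map_zero Dᵀ.vecMulLinear).symm))

/-! ### The cokernel of a matrix -/

/-- If `P` has a generalized inverse `H`, that is `P H P = P`, then the cokernel of `P` embeds into
`R ^ n` by `x ↦ x - x H P`; over a Bézout domain it is therefore free. -/
theorem Matrix.free_quotient_of_mul_mul_eq {R : Type*} [CommRing R] [IsDomain R] [IsBezout R]
    {m n : Type*} [Fintype m] [Fintype n] (P : Matrix m n R) (H : Matrix n m R)
    (hH : P * H * P = P) : Module.Free R ((n → R) ⧸ LinearMap.range P.vecMulLinear) := by
  let g : (n → R) →ₗ[R] (n → R) := LinearMap.id - (H * P).vecMulLinear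
  have hg : LinearMap.range P.vecMulLinear ≤ LinearMap.ker g := by
    rintro _ ⟨y, rfl⟩
    simp [g, Matrix.vecMul_vecMul, ← Matrix.mul_assoc, hH]
  let e := LinearEquiv.funCongrLeft R R (Fintype.equivFin n).symm
  refine Module.Free.of_injective_pi_of_isBezout
    (e.toLinearMap ∘ₗ (LinearMap.range P.vecMulLinear).liftQ g hg)
    (e.injective.comp (LinearMap.ker_eq_bot.1 (Submodule.ker_liftQ_eq_bot _ _ hg ?_)))
  intro x hx
  rw [LinearMap.mem_ker, LinearMap.sub_apply, sub_eq_zero] at hx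
  refine ⟨x ᵥ* H, ?_⟩
  rw [Matrix.vecMulLinear_apply, Matrix.vecMul_vecMul]
  exact hx.symm

/-- If the cokernel of `P` is projective, the row space of `P` is that of an idempotent matrix. -/
theorem Matrix.exists_idempotent_of_projective_quotient {R : Type*} [CommRing R]
    {m n : Type*} [Fintype m] [Fintype n] (P : Matrix m n R)
    [Module.Projective R ((n → R) ⧸ LinearMap.range P.vecMulLinear)] :
    ∃ (e : Matrix n n R) (X : Matrix n m R), e = X * P ∧ P * e = P := by
  classical
  obtain ⟨s, hs⟩ := (LinearMap.range P.vecMulLinear).mkQ.exists_rightInverse_of_surjective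
    (Submodule.range_mkQ _)
  let f : (n → R) →ₗ[R] (n → R) := LinearMap.id - s ∘ₗ (LinearMap.range P.vecMulLinear).mkQ
  have hmem : ∀ x, f x ∈ LinearMap.range P.vecMulLinear := by
    intro x
    rw [← Submodule.Quotient.mk_eq_zero, ← Submodule.mkQ_apply, LinearMap.sub_apply, map_sub,
      sub_eq_zero]
    exact (LinearMap.congr_fun hs _).symm
  have hfix : ∀ x ∈ LinearMap.range P.vecMulLinear, f x = x := by
    intro x hx
    have : (LinearMap.range P.vecMulLinear).mkQ x = 0 := (Submodule.Quotient.mk_eq_zero _).2 hx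
    simp [f, this]
  have hvec : ∀ x, x ᵥ* f.toMatrixRight' = f x := by
    intro x
    have := LinearMap.congr_fun (LinearMap.toMatrixRight'.symm_apply_apply f) x
    exact this
  choose X hX using fun i => hmem (Pi.single i 1)
  refine ⟨f.toMatrixRight', Matrix.of X, ?_, ?_⟩
  · ext i j
    have h1 := hvec (Pi.single i 1)
    rw [Matrix.single_one_vecMul, ← hX i] at h1
    exact congrFun h1 j
  · ext i j
    have h1 := (hvec (P i)).trans (hfix (P i) ?_)
    · exact congrFun h1 j
    · rw [range_vecMulLinear]
      exact Submodule.subset_span ⟨i, rfl⟩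

/-- Over a field, the trace of an idempotent matrix is its rank. -/
theorem Matrix.trace_eq_rank_of_isIdempotentElem {K : Type*} [Field K] {n : Type*} [Fintype n]
    {e : Matrix n n K} (he : IsIdempotentElem e) : e.trace = e.rank := by
  classical
  have hidem : IsIdempotentElem (Matrix.toLin' e) := by
    rw [IsIdempotentElem, Module.End.mul_eq_comp, ← Matrix.toLin'_mul, he.eq]
  rw [← Matrix.trace_toLin'_eq, (LinearMap.IsIdempotentElem.isProj_range _ hidem).trace]
  rfl

open TensorProduct in
/-- The cokernel of a matrix commutes with base change. -/
theorem Matrix.nonempty_baseChange_quotient_equiv {R : Type*} [CommRing R] (A : Type*) [CommRing A]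
    [Algebra R A] {m n : Type*} [Fintype m] [Fintype n] (P : Matrix m n R) :
    Nonempty ((A ⊗[R] ((n → R) ⧸ LinearMap.range P.vecMulLinear)) ≃ₗ[A]
      ((n → A) ⧸ LinearMap.range (P.map (algebraMap R A)).vecMulLinear)) := by
  classical
  let π := (LinearMap.range P.vecMulLinear).mkQ
  have hπ : Function.Surjective π := Submodule.mkQ_surjective _
  have hexact : Function.Exact P.vecMulLinear π := LinearMap.exact_map_mkQ_range _
  have hnat : ∀ y : A ⊗[R] (m → R),
      piScalarRight R A A n (P.vecMulLinear.lTensor A y) =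
        piScalarRight R A A m y ᵥ* P.map (algebraMap R A) := by
    intro y
    induction y with
    | zero => simp
    | add x y hx hy => simp only [map_add, hx, hy, Matrix.add_vecMul]
    | tmul a x =>
      ext j
      simp [Matrix.vecMul, dotProduct, Algebra.smul_def, Finset.mul_sum, mul_comm,
        mul_left_comm]
  let g : (n → A) →ₗ[A] A ⊗[R] ((n → R) ⧸ LinearMap.range P.vecMulLinear) :=
    π.baseChange A ∘ₗ (piScalarRight R A A n).symm.toLinearMap
  have hg : Function.Surjective g :=
    (LinearMap.baseChange_surjective A hπ).comp (piScalarRight R A A n).symm.surjective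
  have hker : LinearMap.ker g = LinearMap.range (P.map (algebraMap R A)).vecMulLinear := by
    ext x
    have hx : g x = π.lTensor A ((piScalarRight R A A n).symm x) := rfl
    rw [LinearMap.mem_ker, hx, lTensor_exact A hexact hπ]
    constructor
    · rintro ⟨y, hy⟩
      refine ⟨piScalarRight R A A m y, ?_⟩
      rw [Matrix.vecMulLinear_apply, ← hnat, hy, LinearEquiv.apply_symm_apply]
    · rintro ⟨y, rfl⟩
      refine ⟨(piScalarRight R A A m).symm y, (piScalarRight R A A n).injective ?_⟩
      rw [hnat, LinearEquiv.apply_symm_apply, LinearEquiv.apply_symm_apply,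
        Matrix.vecMulLinear_apply]
  exact ⟨((Submodule.quotEquivOfEq _ _ hker).symm.trans
    (g.quotKerEquivOfSurjective hg)).symm⟩

/-! ### Rank and evaluation -/

/-- Evaluation of entire functions at `σ`, as a ring homomorphism. -/
def EntireRing.eval (σ : ℂ) : EntireRing →+* ℂ :=
  (Pi.evalRingHom (fun _ : ℂ => ℂ) σ).comp EntireRing.subtype

theorem evalMatrixAt_mul {l m n : Type*} [Fintype m] (A : Matrix l m EntireRing)
    (B : Matrix m n EntireRing) (σ : ℂ) :
    evalMatrixAt (A * B) σ = evalMatrixAt A σ * evalMatrixAt B σ :=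
  Matrix.map_mul (f := EntireRing.eval σ)

theorem EntireRing.exists_ne_zero_of_ne_zero {f : EntireRing} (hf : f ≠ 0) :
    ∃ z, (f : ℂ → ℂ) z ≠ 0 := by
  by_contra! h
  exact hf (Subtype.ext (funext h))

theorem det_evalMatrixAt {n : Type*} [Fintype n] [DecidableEq n] (D : Matrix n n EntireRing)
    (σ : ℂ) : (evalMatrixAt D σ).det = (D.det : ℂ → ℂ) σ :=
  (RingHom.map_det (EntireRing.eval σ) D).symm

/-- If the values of `Q` have constant rank, then so has its nonsingular core `D`; as `D σ` is
invertible for some `σ`, it is so for all, and `det D` is a unit. This makes `G D⁻¹ Y` a generalized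
inverse of `Q`. -/
theorem free_quotient_of_rank_evalMatrixAt_eq {m n : Type*} [Fintype m] [Fintype n]
    (Q : Matrix m n EntireRing) {k : ℕ} (hk : ∀ σ, (evalMatrixAt Q σ).rank = k) :
    Module.Free EntireRing ((n → EntireRing) ⧸ LinearMap.range Q.vecMulLinear) := by
  obtain ⟨t, B, X, Y, D, E, G, hQ, hB, hBD, hDB, hdet⟩ := Q.exists_core_of_isBezout
  have hrank : ∀ σ, (evalMatrixAt D σ).rank = k := by
    intro σ
    have h1 := congrArg (fun A => evalMatrixAt A σ) hQ
    have h2 := congrArg (fun A => evalMatrixAt A σ) hB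
    have h3 := congrArg (fun A => evalMatrixAt A σ) hBD
    have h4 := congrArg (fun A => evalMatrixAt A σ) hDB
    simp only [evalMatrixAt_mul] at h1 h2 h3 h4
    rw [← hk σ]
    apply le_antisymm
    · calc (evalMatrixAt D σ).rank ≤ (evalMatrixAt B σ).rank := by
            rw [h4]; exact Matrix.rank_mul_le_left _ _
        _ ≤ (evalMatrixAt Q σ).rank := by rw [h2]; exact Matrix.rank_mul_le_right _ _
    · calc (evalMatrixAt Q σ).rank ≤ (evalMatrixAt B σ).rank := by
            rw [h1]; exact Matrix.rank_mul_le_right _ _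
        _ ≤ (evalMatrixAt D σ).rank := by rw [h3]; exact Matrix.rank_mul_le_left _ _
  have hkt : k = t := by
    obtain ⟨z, hz⟩ := EntireRing.exists_ne_zero_of_ne_zero hdet
    rw [← hrank z, Matrix.rank_of_isUnit, Fintype.card_fin]
    rw [Matrix.isUnit_iff_isUnit_det, det_evalMatrixAt]
    exact hz.isUnit
  have hunit : IsUnit D.det := by
    refine EntireRing.isUnit_of_forall_ne_zero fun z hz => ?_
    rw [← det_evalMatrixAt] at hz
    obtain ⟨v, hv, hv0⟩ := Matrix.exists_mulVec_eq_zero_iff.2 hz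
    have hsum := (evalMatrixAt D z).mulVecLin.finrank_range_add_finrank_ker
    have hr : Module.finrank ℂ (LinearMap.range (evalMatrixAt D z).mulVecLin) = t :=
      (hrank z).trans hkt
    rw [hr, Module.finrank_fin_fun, Nat.add_eq_left, Submodule.finrank_eq_zero] at hsum
    exact hv (LinearMap.ker_eq_bot'.1 hsum v hv0)
  refine Q.free_quotient_of_mul_mul_eq (G * D⁻¹ * Y) ?_
  calc Q * (G * D⁻¹ * Y) * Q = X * B * (G * D⁻¹ * Y) * Q := by rw [← hQ]
    _ = X * (B * G) * D⁻¹ * (Y * Q) := by simp only [Matrix.mul_assoc]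
    _ = Q := by
        rw [← hB, ← hDB, Matrix.mul_nonsing_inv_cancel_right _ _ hunit, ← hQ]

/-- If the cokernel of `Q` is projective, the rank of `Q σ` is the value at `σ` of the trace of an
idempotent matrix of entire functions, and an entire function with natural values is constant. -/
theorem exists_rank_evalMatrixAt_eq_of_projective {m n : Type*} [Fintype m] [Fintype n]
    (Q : Matrix m n EntireRing)
    [Module.Projective EntireRing ((n → EntireRing) ⧸ LinearMap.range Q.vecMulLinear)] :
    ∃ k : ℕ, ∀ σ, (evalMatrixAt Q σ).rank = k := by
  obtain ⟨e, X, he, hQe⟩ := Q.exists_idempotent_of_projective_quotient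
  have hidem : ∀ σ, IsIdempotentElem (evalMatrixAt e σ) := by
    intro σ
    have hee : e * e = e := by
      nth_rw 1 [he]
      rw [Matrix.mul_assoc, hQe, ← he]
    rw [IsIdempotentElem, ← evalMatrixAt_mul, hee]
  have hrank : ∀ σ, (evalMatrixAt e σ).rank = (evalMatrixAt Q σ).rank := by
    intro σ
    have h1 := congrArg (fun A => evalMatrixAt A σ) he
    have h2 := congrArg (fun A => evalMatrixAt A σ) hQe
    simp only [evalMatrixAt_mul] at h1 h2
    apply le_antisymm
    · rw [h1]; exact Matrix.rank_mul_le_right _ _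
    · rw [← h2]; exact Matrix.rank_mul_le_right _ _
  have htrace : ∀ σ, ((e.trace : EntireRing) : ℂ → ℂ) σ = ((evalMatrixAt Q σ).rank : ℂ) := by
    intro σ
    rw [← hrank, ← Matrix.trace_eq_rank_of_isIdempotentElem (hidem σ)]
    exact AddMonoidHom.map_trace (EntireRing.eval σ) e
  have hcont : Continuous fun σ => (evalMatrixAt Q σ).rank := by
    rw [Nat.isClosedEmbedding_coe_real.isInducing.continuous_iff]
    have h1 : Continuous fun σ => (((e.trace : EntireRing) : ℂ → ℂ) σ).re :=
      Complex.continuous_re.comp (Differentiable.continuous e.trace.2)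
    refine h1.congr fun σ => ?_
    simp [htrace σ]
  exact ⟨_, fun σ => PreconnectedSpace.constant inferInstance hcont (x := σ) (y := 0)⟩

theorem mainTheorem6 {R : Type*} [CommRing R]
    (L : R →+* EntireRing) (hL : Function.Injective L)
    {m n : Type*} [Fintype m] [Fintype n] (P : Matrix m n R)
    (M : Type*) [AddCommGroup M] [Module R M] (hP : IsPresentationMatrix P M) :
    IsSpectrallyControllable L P ↔ IsEntireFreeControllable L M := by
  let : Algebra R EntireRing := L.toAlgebra
  obtain ⟨eM⟩ := hP
  have hrows : Submodule.span R (Set.range fun i : m => P i) = LinearMap.range P.vecMulLinear :=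
    (range_vecMulLinear P).symm
  obtain ⟨eT⟩ := P.nonempty_baseChange_quotient_equiv EntireRing
  let eO : (EntireRing ⊗[R] M) ≃ₗ[EntireRing]
      ((n → EntireRing) ⧸ LinearMap.range (laplaceImage L P).vecMulLinear) :=
    (TensorProduct.AlgebraTensorModule.congr (LinearEquiv.refl EntireRing EntireRing)
      (eM.trans (Submodule.quotEquivOfEq _ _ hrows))).trans eT
  change (∃ k : ℕ, ∀ σ : ℂ, (evalMatrixAt (laplaceImage L P) σ).rank = k) ↔
    Module.Free EntireRing (EntireRing ⊗[R] M)
  constructor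
  · rintro ⟨k, hk⟩
    have := free_quotient_of_rank_evalMatrixAt_eq _ hk
    exact Module.Free.of_equiv eO.symm
  · intro hfree
    have : Module.Free EntireRing
        ((n → EntireRing) ⧸ LinearMap.range (laplaceImage L P).vecMulLinear) :=
      Module.Free.of_equiv eO
    exact exists_rank_evalMatrixAt_eq_of_projective _
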